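/- Let $\pi:Q\to\mathbb R$ be a smooth fibre bundle ($\dim Q=m+1$) with bundle coordinates $(t,q^i)$, where $t$ is the Cartesian coordinate of $\mathbb R$. Let $J^1Q$ be its first order jet manifold with adapted coordinates $(t,q^i,q^i_t)$, and let $\pi_\Pi:V^*Q\to Q$ be its vertical cotangent bundle with holonomic coordinates $(t,q^i,p_i)$; put $\partial_i=\partial/\partial q^i$ and $\partial^i=\partial/\partial p_i$. Let $L=\mathcal L\,dt$, $\mathcal L\in C^\infty(J^1Q)$, be a Lagrangian with Legendre map $\widehat L:J^1Q\to V^*Q$ over $Q$, $p_i\circ\widehat L=\pi_i:=\partial\mathcal L/\partial q^i_t$. Assume that $L$ is almost regular: $N_L=\widehat L(J^1Q)$ is a closed imbedded subbundle of $V^*Q\to Q$, and $\widehat L:J^1Q\to N_L$ is a surjective submersion with connected fibres. Let $H=p_k\,dq^k-\mathcal H\,dt$ be a Hamiltonian form on $V^*Q$, i.e. the pull-back of the Liouville form $p_0\,dt+p_k\,dq^k$ of $T^*Q$ by a smooth global section $p_0=-\mathcal H(t,q^j,p_j)$ of $T^*Q\to V^*Q$, and let $\widehat H:V^*Q\to J^1Q$,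 $q^i_t\circ\widehat H=\partial^i\mathcal H$, be its Hamiltonian map. Assume that $H$ is associated with $L$: $$\widehat L\circ\widehat H\circ\widehat L=\widehat L,\qquad p_i\,\partial^i\mathcal H-\mathcal H=\mathcal L\circ\widehat H .$$ Let $r$ be a smooth section of $V^*Q\to\mathbb R$ over an open subset of $\mathbb R$ which solves the Hamilton equation $q^k_t=\partial^k\mathcal H$, $p_{tk}=-\partial_k\mathcal H$ and takes its values in $N_L$, and let $s=\pi_\Pi\circ r$. Then for every smooth vector field $u=u^t\partial_t+u^i(t,q^j)\partial_i$ on $Q$ with $u^t=0$ or $u^t=1$ we have, on the domain of $r$, $$\mathfrak T_{\widetilde u}(r)=\mathfrak T_u(\pi_\Pi\circ r),\qquad \mathfrak T_{\widetilde u}(\widehat L\circ J^1s)=\mathfrak T_u(s).$$ Here $\mathfrak T_u(s)$ denotes $\mathfrak T_u\circ J^1s$ for the symmetry current $\mathfrak T_u=\pi_i(u^i-u^tq^i_t)+u^t\mathcal L$ on $J^1Q$, which is the contraction of $u$ with the Poincaré–Cartan form $H_L=\pi_i\,dq^i-(\pi_iq^i_t-\mathcal L)\,dt$; $\widetilde u=u^t\partial_t+u^i\partial_i-p_j\,\partial_iu^j\,\partial^i$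 is the canonical lift of $u$ onto $V^*Q$; and $\mathfrak T_{\widetilde u}(r)$ denotes $\mathfrak T_{\widetilde u}\circ r$ for the symmetry current $\mathfrak T_{\widetilde u}=\widetilde u\rfloor H=p_iu^i-u^t\mathcal H$ on $V^*Q$. -/

import Mathlib

open scoped Manifold ContDiff Topology
open Set

noncomputable section

universe u

namespace Mech

/-- The space `ℝ^k` in which the fibre coordinates `q^i` take values. -/
abbrev Fib (k : ℕ) : Type := EuclideanSpace ℝ (Fin k)

/-- The space in which coordinates `(t, q^i)` take values. -/
abbrev Coord (m : ℕ) : Type := ℝ × Fib m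

/-- The space in which coordinates `(t, q^i, q^i_t)` of a velocity space take values. -/
abbrev JetCoord (m : ℕ) : Type := Coord m × Fib m

/-- The space in which coordinates `(t, q^i, p_i)` of a phase space take values; the momenta
`p_i` are the components of a linear form on `ℝ^m`. -/
abbrev PhaseCoord (m : ℕ) : Type := Coord m × (Fib m →L[ℝ] ℝ)

/-- `f : Y → X` is a smooth fibre bundle: it is smoothly locally trivial, with a typical fibre
that is a smooth manifold of dimension `k`. -/
def IsSmoothFibreBundle (VY VX : Type*) [NormedAddCommGroup VY] [NormedSpace ℝ VY]
    [NormedAddCommGroup VX] [NormedSpace ℝ VX]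
    {Y : Type u} [TopologicalSpace Y] [ChartedSpace VY Y]
    {X : Type*} [TopologicalSpace X] [ChartedSpace VX X] (k : ℕ) (f : Y → X) : Prop :=
  ∃ (S : Type u) (_ : TopologicalSpace S) (_ : ChartedSpace (Fib k) S)
    (_ : IsManifold 𝓘(ℝ, Fib k) ∞ S),
    ∀ x : X, ∃ e : Bundle.Trivialization S f, x ∈ e.baseSet ∧
      ContMDiffOn 𝓘(ℝ, VY) (𝓘(ℝ, VX).prod 𝓘(ℝ, Fib k)) ∞ e e.source ∧
      ContMDiffOn (𝓘(ℝ, VX).prod 𝓘(ℝ, Fib k)) 𝓘(ℝ, VY) ∞ e.toOpenPartialHomeomorph.symm e.target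

/-- `π : Q → ℝ` is a smooth fibre bundle whose typical fibre has dimension `m`. -/
class ConfigurationBundle (m : ℕ) {Q : Type u} [TopologicalSpace Q] [ChartedSpace (Coord m) Q]
    (π : Q → ℝ) : Prop where
  isSmoothFibreBundle : IsSmoothFibreBundle (Coord m) ℝ m π

section Charts

variable {m : ℕ} {Q : Type u} [TopologicalSpace Q] [ChartedSpace (Coord m) Q]

variable (m) in
/-- Bundle coordinates `(t, q^i)` on an open subset of `Q`, where `t` is the projection to the
time axis. -/
structure BundleChart (π : Q → ℝ) extends OpenPartialHomeomorph Q (Coord m) where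
  smooth : ContMDiffOn 𝓘(ℝ, Coord m) 𝓘(ℝ, Coord m) ∞ toOpenPartialHomeomorph source
  smooth_symm : ContMDiffOn 𝓘(ℝ, Coord m) 𝓘(ℝ, Coord m) ∞ toOpenPartialHomeomorph.symm target
  fst_eq : ∀ q ∈ source, (toOpenPartialHomeomorph q).1 = π q

theorem exists_bundleChart [IsManifold 𝓘(ℝ, Coord m) ∞ Q] (π : Q → ℝ)
    [h : ConfigurationBundle m π] (q : Q) :
    ∃ φ : BundleChart m π, q ∈ φ.source := by
  obtain ⟨S, _, _, _, hS⟩ := h.isSmoothFibreBundle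
  obtain ⟨e, hq, he, he'⟩ := hS (π q)
  let c := chartAt (Fib m) (e q).2
  let cc : OpenPartialHomeomorph (ℝ × S) (Coord m) := (OpenPartialHomeomorph.refl ℝ).prod c
  have hc : ContMDiffOn (𝓘(ℝ, ℝ).prod 𝓘(ℝ, Fib m)) 𝓘(ℝ, Coord m) ∞ cc cc.source := by
    have h1 := contMDiffOn_chart (I := 𝓘(ℝ, Fib m)) (n := ∞) (x := (e q).2)
    have := (contMDiffOn_id (I := 𝓘(ℝ, ℝ)) (n := ∞) (s := (univ : Set ℝ))).prodMap h1
    rw [modelWithCornersSelf_prod, ← chartedSpaceSelf_prod]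
    exact this
  have hc' : ContMDiffOn 𝓘(ℝ, Coord m) (𝓘(ℝ, ℝ).prod 𝓘(ℝ, Fib m)) ∞ cc.symm cc.target := by
    have h1 := contMDiffOn_chart_symm (I := 𝓘(ℝ, Fib m)) (n := ∞) (x := (e q).2)
    have := (contMDiffOn_id (I := 𝓘(ℝ, ℝ)) (n := ∞) (s := (univ : Set ℝ))).prodMap h1
    rw [modelWithCornersSelf_prod, ← chartedSpaceSelf_prod]
    exact this
  have hqs : q ∈ e.source := e.mem_source.2 hq
  refine ⟨⟨e.toOpenPartialHomeomorph.trans cc, ?_, ?_, ?_⟩, ?_⟩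
  · exact hc.comp' he |>.mono (by intro x hx; simpa using hx)
  · exact he'.comp' hc' |>.mono (by intro x hx; simpa using hx)
  · intro x hx
    have : x ∈ e.source := by simp at hx; simpa using hx.1
    simpa [cc] using e.proj_toFun x this
  · simp [cc, c, hq, e.mem_source]

variable (m) in
/-- The differential `dt = dπ` of the projection to the time axis. -/
def dt (π : Q → ℝ) (q : Q) : TangentSpace 𝓘(ℝ, Coord m) q →L[ℝ] ℝ :=
  mfderiv 𝓘(ℝ, Coord m) 𝓘(ℝ, ℝ) π q

namespace BundleChart

variable {π : Q → ℝ} (φ ψ : BundleChart m π)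

theorem mdifferentiable : φ.toOpenPartialHomeomorph.MDifferentiable 𝓘(ℝ, Coord m) 𝓘(ℝ, Coord m) :=
  ⟨φ.smooth.mdifferentiableOn (by simp), φ.smooth_symm.mdifferentiableOn (by simp)⟩

/-- The differential of a bundle chart at a point of its domain: it sends a tangent vector to its
components `(dt, dq^i)`. -/
def d {q : Q} (hq : q ∈ φ.source) : TangentSpace 𝓘(ℝ, Coord m) q ≃L[ℝ] Coord m :=
  φ.mdifferentiable.mfderiv hq

theorem d_fst {q : Q} (hq : q ∈ φ.source) (v : TangentSpace 𝓘(ℝ, Coord m) q) :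
    (φ.d hq v).1 = dt m π q v := by
  have h1 : HasMFDerivAt 𝓘(ℝ, Coord m) 𝓘(ℝ, ℝ) (Prod.fst ∘ φ.toOpenPartialHomeomorph) q
      ((ContinuousLinearMap.fst ℝ ℝ (Fib m)).comp
        (mfderiv 𝓘(ℝ, Coord m) 𝓘(ℝ, Coord m) φ.toOpenPartialHomeomorph q)) :=
    HasMFDerivAt.comp q (hasFDerivAt_fst.hasMFDerivAt)
      (φ.mdifferentiable.mdifferentiableAt hq).hasMFDerivAt
  have h2 : (Prod.fst ∘ φ.toOpenPartialHomeomorph) =ᶠ[𝓝 q] π :=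
    Filter.mem_of_superset (φ.open_source.mem_nhds hq) fun x hx => φ.fst_eq x hx
  have h3 := h2.mfderiv_eq (I := 𝓘(ℝ, Coord m)) (I' := 𝓘(ℝ, ℝ))
  rw [h1.mfderiv] at h3
  exact congrArg (fun l : TangentSpace 𝓘(ℝ, Coord m) q →L[ℝ] ℝ => l v) h3

theorem fderiv_transition {q : Q} (hφ : q ∈ φ.source) (hψ : q ∈ ψ.source)
    (v : TangentSpace 𝓘(ℝ, Coord m) q) :
    fderiv ℝ (ψ.toOpenPartialHomeomorph ∘ φ.toOpenPartialHomeomorph.symm)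
      (φ.toOpenPartialHomeomorph q) (φ.d hφ v) = ψ.d hψ v := by
  have h0 : φ.toOpenPartialHomeomorph.symm (φ.toOpenPartialHomeomorph q) = q := φ.left_inv hφ
  have h1 : MDifferentiableAt 𝓘(ℝ, Coord m) 𝓘(ℝ, Coord m)
      (ψ.toOpenPartialHomeomorph ∘ φ.toOpenPartialHomeomorph.symm)
      (φ.toOpenPartialHomeomorph q) := by
    refine MDifferentiableAt.comp _ (I' := 𝓘(ℝ, Coord m)) ?_
      (φ.mdifferentiable.mdifferentiableAt_symm (φ.map_source hφ))
    rw [h0]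
    exact ψ.mdifferentiable.mdifferentiableAt hψ
  have h2 := HasMFDerivAt.comp q h1.hasMFDerivAt
    (φ.mdifferentiable.mdifferentiableAt hφ).hasMFDerivAt
  have h3 : ((ψ.toOpenPartialHomeomorph ∘ φ.toOpenPartialHomeomorph.symm) ∘
      φ.toOpenPartialHomeomorph) =ᶠ[𝓝 q] ψ.toOpenPartialHomeomorph :=
    Filter.mem_of_superset (φ.open_source.mem_nhds hφ) fun x hx => by
      have : φ.toOpenPartialHomeomorph.symm (φ.toOpenPartialHomeomorph x) = x := φ.left_inv hx
      simp [this]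
  have h4 := h3.mfderiv_eq (I := 𝓘(ℝ, Coord m)) (I' := 𝓘(ℝ, Coord m))
  rw [h2.mfderiv, mfderiv_eq_fderiv] at h4
  exact congrArg (fun l : TangentSpace 𝓘(ℝ, Coord m) q →L[ℝ] Coord m => l v) h4

/-- The domain, in the coordinates `φ`, of the transition map to the coordinates `ψ`. -/
def overlap : Set (Coord m) := φ.target ∩ φ.toOpenPartialHomeomorph.symm ⁻¹' ψ.source

theorem isOpen_overlap : IsOpen (φ.overlap ψ) :=
  φ.toOpenPartialHomeomorph.isOpen_inter_preimage_symm ψ.open_source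

theorem contDiffOn_transition :
    ContDiffOn ℝ ∞ (ψ.toOpenPartialHomeomorph ∘ φ.toOpenPartialHomeomorph.symm)
      (φ.overlap ψ) := by
  rw [← contMDiffOn_iff_contDiffOn]
  exact ψ.smooth.comp' φ.smooth_symm

end BundleChart

section Bundles

variable (m) (π : Q → ℝ)

/-- The fibre of the first order jet manifold over `q`: the first order jets at `t = π q` of
sections of `Q → ℝ` through `q`, identified with their velocities, which are the tangent vectors
`v` with `dt(v) = 1`. -/
def JetFibre (q : Q) : Type := {v : TangentSpace 𝓘(ℝ, Coord m) q // dt m π q v = 1}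

/-- The first order jet manifold `J¹Q` (the velocity space). -/
def Jet : Type u := Σ q : Q, JetFibre m π q

/-- The fibre of the vertical tangent bundle `VQ` of `Q → ℝ`. -/
abbrev Vert (q : Q) : Submodule ℝ (TangentSpace 𝓘(ℝ, Coord m) q) := (dt m π q).ker

/-- The vertical cotangent bundle `V*Q` (the phase space), the dual of `VQ`. -/
def Phase : Type u := Σ q : Q, Vert m π q →L[ℝ] ℝ

end Bundles

namespace BundleChart

variable {π : Q → ℝ} (φ ψ : BundleChart m π)

/-- The jet at `q` with the jet coordinates `q^i_t = w`. -/
def mkJet {q : Q} (hq : q ∈ φ.source) (w : Fib m) : Jet m π :=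
  ⟨q, (φ.d hq).symm (1, w), by rw [← φ.d_fst hq]; simp⟩

/-- The vertical tangent vector at `q` with components `dq^i = w`. -/
def mkVert {q : Q} (hq : q ∈ φ.source) : Fib m →L[ℝ] Vert m π q :=
  ((φ.d hq).symm.toContinuousLinearMap.comp (ContinuousLinearMap.inr ℝ ℝ (Fib m))).codRestrict _
    (by intro w; change dt m π q _ = 0; rw [← φ.d_fst hq]; simp)

/-- The components `dq^i` of a vertical tangent vector at `q`. -/
def vertComp {q : Q} (hq : q ∈ φ.source) : Vert m π q →L[ℝ] Fib m :=
  ((ContinuousLinearMap.snd ℝ ℝ (Fib m)).comp (φ.d hq).toContinuousLinearMap).comp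
    (Vert m π q).subtypeL

theorem mkVert_vertComp {q : Q} (hq : q ∈ φ.source) (v : Vert m π q) :
    φ.mkVert hq (φ.vertComp hq v) = v := by
  apply Subtype.ext
  change (φ.d hq).symm (0, (φ.d hq v.1).2) = v.1
  rw [ContinuousLinearEquiv.symm_apply_eq]
  ext1
  · rw [φ.d_fst hq]; exact v.2.symm
  · rfl

theorem vertComp_mkVert {q : Q} (hq : q ∈ φ.source) (w : Fib m) :
    φ.vertComp hq (φ.mkVert hq w) = w := by
  change (φ.d hq ((φ.d hq).symm (0, w))).2 = w
  simp

open scoped Classical in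
/-- The coordinates `(t, q^i, q^i_t)` of a jet (zero outside the domain of the chart). -/
def jetFun (z : Jet m π) : JetCoord m :=
  if hq : z.1 ∈ φ.source then (φ.toOpenPartialHomeomorph z.1, (φ.d hq z.2.1).2) else 0

open scoped Classical in
/-- The jet with given coordinates `(t, q^i, q^i_t)` (arbitrary outside the range of the chart). -/
def jetInv [Nonempty (Jet m π)] (x : JetCoord m) : Jet m π :=
  if hx : x.1 ∈ φ.target then φ.mkJet (φ.map_target hx) x.2 else Classical.arbitrary _

open scoped Classical in
/-- The coordinates `(t, q^i, p_i)` of a point of the phase space (zero outside the domain of the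
chart): the linear form with components `p_i` is the covector evaluated on the vertical vectors
with components `dq^i`. -/
def phaseFun (p : Phase m π) : PhaseCoord m :=
  if hq : p.1 ∈ φ.source then (φ.toOpenPartialHomeomorph p.1, p.2.comp (φ.mkVert hq)) else 0

open scoped Classical in
/-- The point of the phase space with given coordinates `(t, q^i, p_i)`. -/
def phaseInv (x : PhaseCoord m) : Phase m π :=
  ⟨φ.toOpenPartialHomeomorph.symm x.1,
    if hx : x.1 ∈ φ.target then x.2.comp (φ.vertComp (φ.map_target hx)) else 0⟩

theorem jetFun_apply {z : Jet m π} (hz : z.1 ∈ φ.source) :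
    φ.jetFun z = (φ.toOpenPartialHomeomorph z.1, (φ.d hz z.2.1).2) := dif_pos hz

theorem jetInv_apply [Nonempty (Jet m π)] {x : JetCoord m} (hx : x.1 ∈ φ.target) :
    φ.jetInv x = φ.mkJet (φ.map_target hx) x.2 := dif_pos hx

theorem phaseFun_apply {p : Phase m π} (hp : p.1 ∈ φ.source) :
    φ.phaseFun p = (φ.toOpenPartialHomeomorph p.1, p.2.comp (φ.mkVert hp)) := dif_pos hp

theorem phaseInv_apply {x : PhaseCoord m} (hx : x.1 ∈ φ.target) :
    φ.phaseInv x = ⟨φ.toOpenPartialHomeomorph.symm x.1,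
      x.2.comp (φ.vertComp (φ.map_target hx))⟩ := by
  rw [phaseInv, dif_pos hx]

/-- The chart `(t, q^i, q^i_t)` of `J¹Q` adapted to the bundle coordinates `(t, q^i)`. -/
def jetChart [Nonempty (Jet m π)] : PartialEquiv (Jet m π) (JetCoord m) where
  toFun := φ.jetFun
  invFun := φ.jetInv
  source := {z | z.1 ∈ φ.source}
  target := {x | x.1 ∈ φ.target}
  map_source' z hz := by
    rw [φ.jetFun_apply hz]
    exact φ.map_source hz
  map_target' x hx := by
    rw [φ.jetInv_apply hx]
    exact φ.map_target hx
  left_inv' z hz := by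
    have hz : z.1 ∈ φ.source := hz
    have h1 : φ.toOpenPartialHomeomorph z.1 ∈ φ.target := φ.map_source hz
    rw [φ.jetFun_apply hz, φ.jetInv_apply h1]
    have h2 : φ.mkJet (φ.map_target h1) (φ.d hz z.2.1).2 = φ.mkJet hz (φ.d hz z.2.1).2 := by
      have key : ∀ (q' : Q) (h' : q' ∈ φ.source), q' = z.1 →
          φ.mkJet h' (φ.d hz z.2.1).2 = φ.mkJet hz (φ.d hz z.2.1).2 := by
        rintro q' h' rfl; rfl
      exact key _ _ (φ.left_inv hz)
    rw [h2]
    refine Sigma.ext rfl (heq_of_eq (Subtype.ext ?_))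
    change (φ.d hz).symm (1, (φ.d hz z.2.1).2) = z.2.1
    rw [ContinuousLinearEquiv.symm_apply_eq]
    ext1
    · rw [φ.d_fst hz]; exact z.2.2.symm
    · rfl
  right_inv' x hx := by
    have hx : x.1 ∈ φ.target := hx
    rw [φ.jetInv_apply hx, φ.jetFun_apply (z := φ.mkJet (φ.map_target hx) x.2) (φ.map_target hx)]
    refine Prod.ext (φ.right_inv hx) ?_
    change (φ.d _ ((φ.d (φ.map_target hx)).symm (1, x.2))).2 = x.2
    rw [ContinuousLinearEquiv.apply_symm_apply]

/-- The chart `(t, q^i, p_i)` of `V*Q` induced by the bundle coordinates `(t, q^i)`. -/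
def phaseChart : PartialEquiv (Phase m π) (PhaseCoord m) where
  toFun := φ.phaseFun
  invFun := φ.phaseInv
  source := {p | p.1 ∈ φ.source}
  target := {x | x.1 ∈ φ.target}
  map_source' p hp := by
    rw [φ.phaseFun_apply hp]
    exact φ.map_source hp
  map_target' x hx := φ.map_target hx
  left_inv' p hp := by
    have hp : p.1 ∈ φ.source := hp
    have h1 : φ.toOpenPartialHomeomorph p.1 ∈ φ.target := φ.map_source hp
    rw [φ.phaseFun_apply hp, φ.phaseInv_apply h1]
    have key : ∀ (q' : Q) (h' : q' ∈ φ.source), q' = p.1 →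
        (⟨q', (p.2.comp (φ.mkVert hp)).comp (φ.vertComp h')⟩ : Phase m π) = p := by
      rintro q' h' rfl
      refine Sigma.ext rfl (heq_of_eq ?_)
      ext v
      change p.2 (φ.mkVert hp (φ.vertComp hp v)) = p.2 v
      rw [φ.mkVert_vertComp hp v]
    exact key _ _ (φ.left_inv hp)
  right_inv' x hx := by
    have hx : x.1 ∈ φ.target := hx
    rw [φ.phaseInv_apply hx, φ.phaseFun_apply (p := ⟨φ.toOpenPartialHomeomorph.symm x.1,
      x.2.comp (φ.vertComp (φ.map_target hx))⟩) (φ.map_target hx)]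
    refine Prod.ext (φ.right_inv hx) ?_
    ext1 w
    change x.2 (φ.vertComp _ (φ.mkVert _ w)) = x.2 w
    rw [φ.vertComp_mkVert]

theorem jetChart_apply [Nonempty (Jet m π)] {z : Jet m π} (hz : z.1 ∈ φ.source) :
    φ.jetChart z = (φ.toOpenPartialHomeomorph z.1, (φ.d hz z.2.1).2) := φ.jetFun_apply hz

theorem jetChart_symm_apply [Nonempty (Jet m π)] {x : JetCoord m} (hx : x.1 ∈ φ.target) :
    φ.jetChart.symm x = φ.mkJet (φ.map_target hx) x.2 := φ.jetInv_apply hx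

theorem phaseChart_apply {p : Phase m π} (hp : p.1 ∈ φ.source) :
    φ.phaseChart p = (φ.toOpenPartialHomeomorph p.1, p.2.comp (φ.mkVert hp)) :=
  φ.phaseFun_apply hp

theorem phaseChart_symm_apply {x : PhaseCoord m} (hx : x.1 ∈ φ.target) :
    φ.phaseChart.symm x = ⟨φ.toOpenPartialHomeomorph.symm x.1,
      x.2.comp (φ.vertComp (φ.map_target hx))⟩ := φ.phaseInv_apply hx

theorem jet_source [Nonempty (Jet m π)] :
    (φ.jetChart.symm.trans ψ.jetChart).source = Prod.fst ⁻¹' φ.overlap ψ := by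
  ext x
  simp only [PartialEquiv.trans_source, PartialEquiv.symm_source, overlap]
  constructor
  · rintro ⟨h1, h2⟩
    refine ⟨h1, ?_⟩
    have h1 : x.1 ∈ φ.target := h1
    rw [mem_preimage, φ.jetChart_symm_apply h1] at h2
    exact h2
  · rintro ⟨h1, h2⟩
    refine ⟨h1, ?_⟩
    rw [mem_preimage, φ.jetChart_symm_apply h1]
    exact h2

theorem phase_source :
    (φ.phaseChart.symm.trans ψ.phaseChart).source = Prod.fst ⁻¹' φ.overlap ψ := by
  rfl

theorem contDiffOn_jet [Nonempty (Jet m π)] :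
    ContDiffOn ℝ ∞ (φ.jetChart.symm.trans ψ.jetChart) (Prod.fst ⁻¹' φ.overlap ψ) := by
  have hτ := φ.contDiffOn_transition ψ
  have hd := hτ.fderiv_of_isOpen (m := ∞) (φ.isOpen_overlap ψ) (by simp)
  have hf : ContDiffOn ℝ ∞ (Prod.fst : JetCoord m → Coord m) (Prod.fst ⁻¹' φ.overlap ψ) :=
    contDiff_fst.contDiffOn
  have h1 := hτ.comp hf (fun x hx => hx)
  have h2 : ContDiffOn ℝ ∞ (fun x : JetCoord m =>
      (fderiv ℝ (ψ.toOpenPartialHomeomorph ∘ φ.toOpenPartialHomeomorph.symm) x.1 (1, x.2)).2)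
      (Prod.fst ⁻¹' φ.overlap ψ) :=
    contDiff_snd.comp_contDiffOn ((hd.comp hf (fun x hx => hx)).clm_apply
      (contDiffOn_const.prodMk contDiff_snd.contDiffOn))
  refine (h1.prodMk h2).congr ?_
  intro x hx
  have hx1 : x.1 ∈ φ.target := hx.1
  have hx2 : φ.toOpenPartialHomeomorph.symm x.1 ∈ ψ.source := hx.2
  change ψ.jetChart (φ.jetChart.symm x) = _
  rw [φ.jetChart_symm_apply hx1, ψ.jetChart_apply (z := φ.mkJet (φ.map_target hx1) x.2) hx2]
  refine Prod.ext rfl ?_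
  have := φ.fderiv_transition ψ (φ.map_target hx1) hx2 ((φ.d (φ.map_target hx1)).symm (1, x.2))
  have h0 : φ.toOpenPartialHomeomorph (φ.toOpenPartialHomeomorph.symm x.1) = x.1 :=
    φ.right_inv hx1
  rw [ContinuousLinearEquiv.apply_symm_apply] at this
  change (ψ.d hx2 ((φ.d (φ.map_target hx1)).symm (1, x.2))).2 = _
  rw [← this]
  rw [h0]

theorem contDiffOn_phase :
    ContDiffOn ℝ ∞ (φ.phaseChart.symm.trans ψ.phaseChart) (Prod.fst ⁻¹' φ.overlap ψ) := by
  have hτ := φ.contDiffOn_transition ψ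
  have hσ := ψ.contDiffOn_transition φ
  have hd := hσ.fderiv_of_isOpen (m := ∞) (ψ.isOpen_overlap φ) (by simp)
  have hf : ContDiffOn ℝ ∞ (Prod.fst : PhaseCoord m → Coord m) (Prod.fst ⁻¹' φ.overlap ψ) :=
    contDiff_fst.contDiffOn
  have h1 := hτ.comp hf (fun x hx => hx)
  have hm : MapsTo (ψ.toOpenPartialHomeomorph ∘ φ.toOpenPartialHomeomorph.symm)
      (φ.overlap ψ) (ψ.overlap φ) := by
    intro x hx
    refine ⟨ψ.map_source hx.2, ?_⟩
    have h0 : ψ.toOpenPartialHomeomorph.symm (ψ.toOpenPartialHomeomorph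
      (φ.toOpenPartialHomeomorph.symm x)) = φ.toOpenPartialHomeomorph.symm x := ψ.left_inv hx.2
    change ψ.toOpenPartialHomeomorph.symm (ψ.toOpenPartialHomeomorph
      (φ.toOpenPartialHomeomorph.symm x)) ∈ φ.source
    rw [h0]
    exact φ.map_target hx.1
  have h2 : ContDiffOn ℝ ∞ (fun x : PhaseCoord m =>
      x.2.comp ((ContinuousLinearMap.snd ℝ ℝ (Fib m)).comp
        ((fderiv ℝ (φ.toOpenPartialHomeomorph ∘ ψ.toOpenPartialHomeomorph.symm)
          ((ψ.toOpenPartialHomeomorph ∘ φ.toOpenPartialHomeomorph.symm) x.1)).comp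
          (ContinuousLinearMap.inr ℝ ℝ (Fib m)))))
      (Prod.fst ⁻¹' φ.overlap ψ) :=
    contDiff_snd.contDiffOn.clm_comp (contDiffOn_const.clm_comp
      ((hd.comp h1 (fun x hx => hm hx)).clm_comp contDiffOn_const))
  refine (h1.prodMk h2).congr ?_
  intro x hx
  have hx1 : x.1 ∈ φ.target := hx.1
  have hx2 : φ.toOpenPartialHomeomorph.symm x.1 ∈ ψ.source := hx.2
  change ψ.phaseChart (φ.phaseChart.symm x) = _
  rw [φ.phaseChart_symm_apply hx1, ψ.phaseChart_apply
    (p := ⟨φ.toOpenPartialHomeomorph.symm x.1, x.2.comp (φ.vertComp (φ.map_target hx1))⟩) hx2]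
  refine Prod.ext rfl ?_
  ext1 w
  have := ψ.fderiv_transition φ hx2 (φ.map_target hx1) ((ψ.d hx2).symm (0, w))
  rw [ContinuousLinearEquiv.apply_symm_apply] at this
  change x.2 ((φ.d (φ.map_target hx1) ((ψ.d hx2).symm (0, w))).2) = _
  rw [← this]
  rfl

end BundleChart

section Manifolds

variable (m) (π : Q → ℝ) [IsManifold 𝓘(ℝ, Coord m) ∞ Q] [ConfigurationBundle m π]

/-- A bundle chart around `q`. Below it is used to write down coordinate expressions that do not
depend on the choice of the bundle chart. -/
def bundleChartAt (q : Q) : BundleChart m π := (exists_bundleChart π q).choose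

theorem mem_bundleChartAt_source (q : Q) : q ∈ (bundleChartAt m π q).source :=
  (exists_bundleChart π q).choose_spec

/-- The atlas of adapted coordinates `(t, q^i, q^i_t)` on `J¹Q`. -/
def jetCore : ChartedSpaceCore (JetCoord m) (Jet m π) where
  atlas := {e | ∃ (φ : BundleChart m π) (_ : Nonempty (Jet m π)), e = φ.jetChart}
  chartAt z := haveI : Nonempty (Jet m π) := ⟨z⟩; (bundleChartAt m π z.1).jetChart
  mem_chart_source z := mem_bundleChartAt_source m π z.1
  chart_mem_atlas z := ⟨_, ⟨z⟩, rfl⟩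
  open_source := by
    rintro _ _ ⟨φ, h, rfl⟩ ⟨ψ, _, rfl⟩
    rw [φ.jet_source ψ]
    exact (φ.isOpen_overlap ψ).preimage continuous_fst
  continuousOn_toFun := by
    rintro _ _ ⟨φ, h, rfl⟩ ⟨ψ, _, rfl⟩
    rw [φ.jet_source ψ]
    exact (φ.contDiffOn_jet ψ).continuousOn

/-- The atlas of holonomic coordinates `(t, q^i, p_i)` on `V*Q`. -/
def phaseCore : ChartedSpaceCore (PhaseCoord m) (Phase m π) where
  atlas := range (fun φ : BundleChart m π => φ.phaseChart)
  chartAt p := (bundleChartAt m π p.1).phaseChart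
  mem_chart_source p := mem_bundleChartAt_source m π p.1
  chart_mem_atlas p := ⟨_, rfl⟩
  open_source := by
    rintro _ _ ⟨φ, rfl⟩ ⟨ψ, rfl⟩
    rw [φ.phase_source ψ]
    exact (φ.isOpen_overlap ψ).preimage continuous_fst
  continuousOn_toFun := by
    rintro _ _ ⟨φ, rfl⟩ ⟨ψ, rfl⟩
    rw [φ.phase_source ψ]
    exact (φ.contDiffOn_phase ψ).continuousOn

instance : TopologicalSpace (Jet m π) := (jetCore m π).toTopologicalSpace
instance : ChartedSpace (JetCoord m) (Jet m π) := (jetCore m π).toChartedSpace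
instance : TopologicalSpace (Phase m π) := (phaseCore m π).toTopologicalSpace
instance : ChartedSpace (PhaseCoord m) (Phase m π) := (phaseCore m π).toChartedSpace

instance : IsManifold 𝓘(ℝ, JetCoord m) ∞ (Jet m π) := by
  apply isManifold_of_contDiffOn
  intro e e' he he'
  obtain ⟨_, ⟨_, rfl⟩, _, ⟨⟨φ, _, rfl⟩, rfl⟩, he⟩ := he
  obtain ⟨_, ⟨_, rfl⟩, _, ⟨⟨ψ, _, rfl⟩, rfl⟩, he'⟩ := he'
  rw [mem_singleton_iff] at he he'
  subst he he'
  refine (φ.contDiffOn_jet ψ).mono ?_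
  rw [← φ.jet_source ψ]
  intro x hx
  exact hx.1

instance : IsManifold 𝓘(ℝ, PhaseCoord m) ∞ (Phase m π) := by
  apply isManifold_of_contDiffOn
  intro e e' he he'
  obtain ⟨_, ⟨_, rfl⟩, _, ⟨⟨φ, rfl⟩, rfl⟩, he⟩ := he
  obtain ⟨_, ⟨_, rfl⟩, _, ⟨⟨ψ, rfl⟩, rfl⟩, he'⟩ := he'
  rw [mem_singleton_iff] at he he'
  subst he he'
  refine (φ.contDiffOn_phase ψ).mono ?_
  rw [← φ.phase_source ψ]
  intro x hx
  exact hx.1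

end Manifolds

section Projections

variable (m) (π : Q → ℝ) [IsManifold 𝓘(ℝ, Coord m) ∞ Q] [ConfigurationBundle m π]

/-- The projection `π_Π : V*Q → Q`. -/
def legendreBundle (p : Phase m π) : Q := p.1

theorem contMDiff_legendreBundle :
    ContMDiff 𝓘(ℝ, PhaseCoord m) 𝓘(ℝ, Coord m) ∞ (legendreBundle m π) := by
  intro p
  set φ := bundleChartAt m π p.1 with hφ
  have h1 : ContMDiffOn 𝓘(ℝ, PhaseCoord m) 𝓘(ℝ, PhaseCoord m) ∞ (chartAt (PhaseCoord m) p)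
      (chartAt (PhaseCoord m) p).source := contMDiffOn_chart
  have h2 : ContMDiffOn 𝓘(ℝ, PhaseCoord m) 𝓘(ℝ, Coord m) ∞ (Prod.fst : PhaseCoord m → Coord m)
      univ := contDiff_fst.contMDiff.contMDiffOn
  have h3 := φ.smooth_symm.comp' (h2.comp' h1)
  have hsrc : ∀ x ∈ (chartAt (PhaseCoord m) p).source, x.1 ∈ φ.source := fun x hx => hx
  have hval : ∀ x ∈ (chartAt (PhaseCoord m) p).source,
      ((chartAt (PhaseCoord m) p) x).1 = φ.toOpenPartialHomeomorph x.1 := fun x hx =>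
    congrArg Prod.fst (φ.phaseChart_apply (hsrc x hx))
  have hp := mem_chart_source (PhaseCoord m) p
  have h4 : ContMDiffOn 𝓘(ℝ, PhaseCoord m) 𝓘(ℝ, Coord m) ∞ (legendreBundle m π)
      (chartAt (PhaseCoord m) p).source := by
    refine (h3.mono ?_).congr ?_
    · intro x hx
      refine ⟨⟨hx, mem_univ _⟩, ?_⟩
      change ((chartAt (PhaseCoord m) p) x).1 ∈ φ.target
      rw [hval x hx]
      exact φ.map_source (hsrc x hx)
    · intro x hx
      change x.1 = φ.toOpenPartialHomeomorph.symm ((chartAt (PhaseCoord m) p) x).1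
      rw [hval x hx]
      exact (φ.left_inv (hsrc x hx)).symm
  exact h4.contMDiffAt ((chartAt (PhaseCoord m) p).open_source.mem_nhds hp)

theorem mdifferentiableAt_proj (q : Q) : MDifferentiableAt 𝓘(ℝ, Coord m) 𝓘(ℝ, ℝ) π q := by
  set φ := bundleChartAt m π q with hφ
  have hq : q ∈ φ.source := mem_bundleChartAt_source m π q
  have h1 : HasMFDerivAt 𝓘(ℝ, Coord m) 𝓘(ℝ, ℝ) (Prod.fst ∘ φ.toOpenPartialHomeomorph) q
      ((ContinuousLinearMap.fst ℝ ℝ (Fib m)).comp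
        (mfderiv 𝓘(ℝ, Coord m) 𝓘(ℝ, Coord m) φ.toOpenPartialHomeomorph q)) :=
    HasMFDerivAt.comp q (hasFDerivAt_fst.hasMFDerivAt)
      (φ.mdifferentiable.mdifferentiableAt hq).hasMFDerivAt
  have h2 : π =ᶠ[𝓝 q] (Prod.fst ∘ φ.toOpenPartialHomeomorph) :=
    Filter.mem_of_superset (φ.open_source.mem_nhds hq) fun x hx => (φ.fst_eq x hx).symm
  exact (h1.congr_of_eventuallyEq h2).mdifferentiableAt

end Projections

section Sections

/-- A smooth section of `p : E → ℝ` over an open subset of the time axis. -/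
structure LocalSection (VE : Type*) [NormedAddCommGroup VE] [NormedSpace ℝ VE] {E : Type*}
    [TopologicalSpace E] [ChartedSpace VE E] (p : E → ℝ) where
  domain : Set ℝ
  isOpen_domain : IsOpen domain
  toFun : ℝ → E
  smooth : ContMDiffOn 𝓘(ℝ, ℝ) 𝓘(ℝ, VE) ∞ toFun domain
  isSection : ∀ t ∈ domain, p (toFun t) = t

variable {π : Q → ℝ} [IsManifold 𝓘(ℝ, Coord m) ∞ Q] [ConfigurationBundle m π]

/-- The jet prolongation `J¹s` of a section `s` of `Q → ℝ`. -/
def LocalSection.jet (s : LocalSection (Coord m) π) (t : s.domain) : Jet m π :=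
  ⟨s.toFun t, (mfderiv 𝓘(ℝ, ℝ) 𝓘(ℝ, Coord m) s.toFun t : ℝ →L[ℝ] _) 1, by
    have hU := s.isOpen_domain.mem_nhds t.2
    have h1 := (s.smooth.contMDiffAt hU).mdifferentiableAt (by simp)
    have h2 := HasMFDerivAt.comp (t : ℝ) (mdifferentiableAt_proj m π (s.toFun t)).hasMFDerivAt
      h1.hasMFDerivAt
    have h3 : (π ∘ s.toFun) =ᶠ[𝓝 (t : ℝ)] id :=
      Filter.mem_of_superset hU fun x hx => s.isSection x hx
    have h4 := h3.mfderiv_eq (I := 𝓘(ℝ, ℝ)) (I' := 𝓘(ℝ, ℝ))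
    rw [h2.mfderiv, mfderiv_id] at h4
    exact congrArg (fun l : ℝ →L[ℝ] ℝ => l 1) h4⟩

/-- The section `π_Π ∘ r` of `Q → ℝ` for a section `r` of `V*Q → ℝ`. -/
def LocalSection.base (r : LocalSection (PhaseCoord m) (π ∘ legendreBundle m π)) :
    LocalSection (Coord m) π where
  domain := r.domain
  isOpen_domain := r.isOpen_domain
  toFun := legendreBundle m π ∘ r.toFun
  smooth := (contMDiff_legendreBundle m π).comp_contMDiffOn r.smooth
  isSection := r.isSection

end Sections

section Dynamics

variable (m) (π : Q → ℝ) [IsManifold 𝓘(ℝ, Coord m) ∞ Q] [ConfigurationBundle m π]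

/-- A smooth vector field `u = u^t ∂_t + u^i(t, q^j) ∂_i` on `Q` with `u^t = 0` or `u^t = 1`. -/
structure ConfigurationField where
  toFun : ∀ q : Q, TangentSpace 𝓘(ℝ, Coord m) q
  smooth : ContMDiff 𝓘(ℝ, Coord m) 𝓘(ℝ, Coord m).tangent ∞
    (fun q => (⟨q, toFun q⟩ : TangentBundle 𝓘(ℝ, Coord m) Q))
  timeComponent : ℝ
  timeComponent_eq : timeComponent = 0 ∨ timeComponent = 1
  dt_eq : ∀ q, dt m π q (toFun q) = timeComponent

/-- A first order Lagrangian `L = 𝓛 dt`, given by the smooth function `𝓛` on `J¹Q`. -/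
structure Lagrangian where
  toFun : Jet m π → ℝ
  smooth : ContMDiff 𝓘(ℝ, JetCoord m) 𝓘(ℝ, ℝ) ∞ toFun

/-- A Hamiltonian form `H = p_k dq^k - 𝓗 dt`, given by the smooth section
`p ↦ (p_0 = -𝓗, p_i)` of `ζ : T*Q → V*Q`, where `ζ` is the restriction of covectors to vertical
vectors. -/
structure HamiltonianForm where
  toFun : ∀ p : Phase m π, TangentSpace 𝓘(ℝ, Coord m) p.1 →L[ℝ] ℝ
  restrict : ∀ (p : Phase m π) (v : Vert m π p.1), toFun p v = p.2 v
  smooth : ContMDiff 𝓘(ℝ, PhaseCoord m) (𝓘(ℝ, Coord m).prod 𝓘(ℝ, Coord m →L[ℝ] ℝ)) ∞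
    (fun p => (⟨p.1, toFun p⟩ : Bundle.TotalSpace (Coord m →L[ℝ] ℝ)
      (fun q : Q => TangentSpace 𝓘(ℝ, Coord m) q →L[ℝ] Bundle.Trivial Q ℝ q)))

variable {m π}

namespace Lagrangian

variable (L : Lagrangian m π)

/-- The components `π_i = ∂𝓛/∂q^i_t` of the Legendre map, as an element of the dual of the
vertical tangent space. -/
def legendre (z : Jet m π) : Vert m π z.1 →L[ℝ] ℝ :=
  let φ := bundleChartAt m π z.1
  let hq := mem_bundleChartAt_source m π z.1
  (fderiv ℝ (fun w : Fib m => L.toFun (φ.mkJet hq w)) (φ.d hq z.2.1).2).comp (φ.vertComp hq)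

/-- The Legendre map `L̂ : J¹Q → V*Q` over `Q`, `p_i ∘ L̂ = π_i`. -/
def legendreMap (z : Jet m π) : Phase m π := ⟨z.1, L.legendre z⟩

/-- The Lagrangian constraint space `N_L = L̂(J¹Q)`. -/
def constraintSpace : Set (Phase m π) := range L.legendreMap

/-- `L` is almost regular: `N_L` is a closed imbedded subbundle of `V*Q → Q` (the image of a
smooth fibre bundle `N → Q` under a smooth embedding `i` over `Q`), and `L̂ : J¹Q → N_L` is a
fibred manifold (a surjective submersion) with connected fibres. -/
def IsAlmostRegular : Prop :=
  ∃ (k l : ℕ) (N : Type u) (_ : TopologicalSpace N) (_ : ChartedSpace (Fib k) N)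
    (_ : IsManifold 𝓘(ℝ, Fib k) ∞ N) (i : N → Phase m π) (ℓ : Jet m π → N),
    Manifold.IsSmoothEmbedding 𝓘(ℝ, Fib k) 𝓘(ℝ, PhaseCoord m) ∞ i ∧
    range i = L.constraintSpace ∧ IsClosed L.constraintSpace ∧
    IsSmoothFibreBundle (Fib k) (Coord m) l (legendreBundle m π ∘ i) ∧
    i ∘ ℓ = L.legendreMap ∧
    Manifold.IsSubmersion 𝓘(ℝ, JetCoord m) 𝓘(ℝ, Fib k) ∞ ℓ ∧
    ∀ n : N, IsConnected (ℓ ⁻¹' {n})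

/-- The vertical part `X - dt(X) z` of a tangent vector `X` relative to a jet `z`, with components
`X^i - X^t q^i_t`. -/
def vertPart (z : Jet m π) : TangentSpace 𝓘(ℝ, Coord m) z.1 →L[ℝ] Vert m π z.1 :=
  (ContinuousLinearMap.id ℝ (TangentSpace 𝓘(ℝ, Coord m) z.1) -
    (dt m π z.1).smulRight z.2.1).codRestrict _ (by
      intro X
      have hz := z.2.2
      change dt m π z.1 (X - dt m π z.1 X • z.2.1) = 0
      rw [map_sub, map_smul, hz]
      simp)

/-- The Poincaré--Cartan form `H_L = π_i dq^i - (π_i q^i_t - 𝓛) dt`, as a map `J¹Q → T*Q`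
over `Q`. -/
def poincareCartan (z : Jet m π) : TangentSpace 𝓘(ℝ, Coord m) z.1 →L[ℝ] ℝ :=
  (L.legendre z).comp (vertPart z) + L.toFun z • dt m π z.1

/-- The symmetry current `𝔗_u = u ⌋ H_L = π_i (u^i - u^t q^i_t) + u^t 𝓛` on `J¹Q`. -/
def symmetryCurrent (u : ConfigurationField m π) (z : Jet m π) : ℝ :=
  L.poincareCartan z (u.toFun z.1)

end Lagrangian

/-- The components of tangent vectors to `V*Q` at `p` in the coordinates `(t, q^i, p_i)`. -/
def phaseFrame (p : Phase m π) : TangentSpace 𝓘(ℝ, PhaseCoord m) p ≃L[ℝ] PhaseCoord m :=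
  (mdifferentiable_chart (I := 𝓘(ℝ, PhaseCoord m)) p).mfderiv (mem_chart_source _ p)

/-- The components `(u^t, u^i)` of a vector field on `Q` in bundle coordinates, as functions of
the coordinates `(t, q^i)`. -/
def ConfigurationField.components (u : ConfigurationField m π) (φ : BundleChart m π)
    (x : Coord m) : Coord m :=
  (mfderiv 𝓘(ℝ, Coord m) 𝓘(ℝ, Coord m) φ.toOpenPartialHomeomorph
    (φ.toOpenPartialHomeomorph.symm x) : _ →L[ℝ] Coord m)
    (u.toFun (φ.toOpenPartialHomeomorph.symm x))

/-- The canonical lift `ũ = u^t ∂_t + u^i ∂_i - p_j ∂_i u^j ∂^i` onto `V*Q` of a vector field `u`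
on `Q`. -/
def ConfigurationField.lift (u : ConfigurationField m π) (p : Phase m π) :
    TangentSpace 𝓘(ℝ, PhaseCoord m) p :=
  let φ := bundleChartAt m π p.1
  let x := φ.phaseFun p
  (phaseFrame p).symm (u.components φ x.1,
    -(x.2.comp ((ContinuousLinearMap.snd ℝ ℝ (Fib m)).comp
      ((fderiv ℝ (u.components φ) x.1).comp (ContinuousLinearMap.inr ℝ ℝ (Fib m))))))

namespace HamiltonianForm

variable (H : HamiltonianForm m π)

/-- The Hamiltonian form `H` as a one-form on `V*Q`: the pull-back of the Liouville form
on `T*Q`. -/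
def form (p : Phase m π) : TangentSpace 𝓘(ℝ, PhaseCoord m) p →L[ℝ] ℝ :=
  (H.toFun p).comp (mfderiv 𝓘(ℝ, PhaseCoord m) 𝓘(ℝ, Coord m) (legendreBundle m π) p)

/-- The Hamiltonian `𝓗 = -p_0` in bundle coordinates, as a function of the coordinates
`(t, q^i, p_i)`. -/
def hamiltonian (φ : BundleChart m π) (x : PhaseCoord m) : ℝ :=
  -H.toFun (φ.phaseInv x) ((mfderiv 𝓘(ℝ, Coord m) 𝓘(ℝ, Coord m)
    φ.toOpenPartialHomeomorph.symm x.1 : Coord m →L[ℝ] _) (1, 0))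

/-- The derivatives `∂^i 𝓗 = ∂𝓗/∂p_i`. -/
def momentumDeriv (φ : BundleChart m π) (x : PhaseCoord m) : Fib m :=
  WithLp.toLp 2 fun i => fderiv ℝ (H.hamiltonian φ) x (0, EuclideanSpace.proj i)

/-- The derivatives `∂_i 𝓗 = ∂𝓗/∂q^i`, as a linear form in `dq^i`. -/
def positionDeriv (φ : BundleChart m π) (x : PhaseCoord m) : Fib m →L[ℝ] ℝ :=
  (fderiv ℝ (H.hamiltonian φ) x).comp
    ((ContinuousLinearMap.inl ℝ (Coord m) (Fib m →L[ℝ] ℝ)).comp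
      (ContinuousLinearMap.inr ℝ ℝ (Fib m)))

/-- The Hamiltonian map `Ĥ : V*Q → J¹Q` over `Q`, `q^i_t ∘ Ĥ = ∂^i 𝓗`. -/
def hamiltonianMap (p : Phase m π) : Jet m π :=
  let φ := bundleChartAt m π p.1
  φ.mkJet (mem_bundleChartAt_source m π p.1) (H.momentumDeriv φ (φ.phaseFun p))

/-- The Hamilton vector field `γ_H = ∂_t + ∂^k 𝓗 ∂_k - ∂_k 𝓗 ∂^k` on `V*Q`. -/
def hamiltonField (p : Phase m π) : TangentSpace 𝓘(ℝ, PhaseCoord m) p :=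
  let φ := bundleChartAt m π p.1
  let x := φ.phaseFun p
  (phaseFrame p).symm ((1, H.momentumDeriv φ x), -H.positionDeriv φ x)

/-- The section `r` of `V*Q → ℝ` is a solution of the Hamilton equation
`q^k_t = ∂^k 𝓗`, `p_{tk} = -∂_k 𝓗`. -/
def IsSolution (r : LocalSection (PhaseCoord m) (π ∘ legendreBundle m π)) : Prop :=
  IsMIntegralCurveOn r.toFun H.hamiltonField r.domain

/-- The Lagrangian `L_H = (p_i q^i_t - 𝓗) dt` on `V*Q ×_Q J¹Q`. -/
def lagrangian (p : Phase m π) (v : JetFibre m π p.1) : ℝ := H.toFun p v.1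

/-- `H` is associated with `L`: `L̂ ∘ Ĥ ∘ L̂ = L̂` and `Ĥ^* L_H = Ĥ^* L`. -/
def IsAssociated (L : Lagrangian m π) : Prop :=
  L.legendreMap ∘ H.hamiltonianMap ∘ L.legendreMap = L.legendreMap ∧
  ∀ p : Phase m π, H.lagrangian p (H.hamiltonianMap p).2 = L.toFun (H.hamiltonianMap p)

/-- The symmetry current `𝔗_υ = υ ⌋ H = p_i υ^i - u^t 𝓗` of a vector field `υ` on `V*Q`. -/
def symmetryCurrent (υ : ∀ p : Phase m π, TangentSpace 𝓘(ℝ, PhaseCoord m) p)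
    (p : Phase m π) : ℝ :=
  H.form p (υ p)

end HamiltonianForm

end Dynamics

end Charts

end Mech

end

/-!
The differential of `π_Π : V*Q → Q` forgets the momentum components
(`Mech.d_mfderiv_legendreBundle`). It therefore sends the canonical lift `ũ` to `u`, and the
Hamilton vector field at `p` to the velocity of the jet `Ĥ(p)`. The second fact says that a solution
`r` of the Hamilton equation satisfies `J¹(π_Π ∘ r) = Ĥ ∘ r` (`Mech.jet_base_of_isSolution`); since
`r` takes its values in `N_L = L̂(J¹Q)`, the identity `L̂ ∘ Ĥ ∘ L̂ = L̂` gives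
`L̂ ∘ J¹(π_Π ∘ r) = r`. Hence both equations reduce to
the pointwise identity `𝔗_ũ(p) = 𝔗_u(Ĥ(p))` for `p ∈ N_L`. There, the component of `u` vertical
relative to `Ĥ(p)` is paired on both sides with the covector `p`, and the remaining component
`u^t Ĥ(p)` gives `u^t L_H` on one side and `u^t 𝓛` on the other, which agree because `H` is
associated with `L`.
-/

noncomputable section

namespace Mech

variable {m : ℕ} {Q : Type u} [TopologicalSpace Q] [ChartedSpace (Coord m) Q]
  [IsManifold 𝓘(ℝ, Coord m) ∞ Q] {π : Q → ℝ}

theorem ConfigurationField.components_apply (u : ConfigurationField m π) (φ : BundleChart m π)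
    {q : Q} (hq : q ∈ φ.source) :
    u.components φ (φ.toOpenPartialHomeomorph q) = φ.d hq (u.toFun q) := by
  have key : ∀ q' : Q, q' = q →
      (mfderiv 𝓘(ℝ, Coord m) 𝓘(ℝ, Coord m) φ.toOpenPartialHomeomorph q' : _ →L[ℝ] Coord m)
        (u.toFun q') = φ.d hq (u.toFun q) := by
    rintro q' rfl; rfl
  exact key _ (φ.left_inv hq)

variable [ConfigurationBundle m π]

/-- In adapted coordinates, the differential of `V*Q → Q` forgets the components `dp_i`. -/
theorem d_mfderiv_legendreBundle (p : Phase m π) (X : TangentSpace 𝓘(ℝ, PhaseCoord m) p) :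
    (bundleChartAt m π p.1).d (mem_bundleChartAt_source m π p.1)
      (mfderiv 𝓘(ℝ, PhaseCoord m) 𝓘(ℝ, Coord m) (legendreBundle m π) p X) =
    (phaseFrame p X).1 := by
  set φ := bundleChartAt m π p.1 with hφ
  have hq : p.1 ∈ φ.source := mem_bundleChartAt_source m π p.1
  have h1 : HasMFDerivAt 𝓘(ℝ, PhaseCoord m) 𝓘(ℝ, Coord m)
      (φ.toOpenPartialHomeomorph ∘ legendreBundle m π) p
      ((mfderiv 𝓘(ℝ, Coord m) 𝓘(ℝ, Coord m) φ.toOpenPartialHomeomorph p.1).comp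
        (mfderiv 𝓘(ℝ, PhaseCoord m) 𝓘(ℝ, Coord m) (legendreBundle m π) p)) :=
    HasMFDerivAt.comp p (φ.mdifferentiable.mdifferentiableAt hq).hasMFDerivAt
      ((contMDiff_legendreBundle m π).mdifferentiable (by simp) p).hasMFDerivAt
  have h2 : HasMFDerivAt 𝓘(ℝ, PhaseCoord m) 𝓘(ℝ, Coord m)
      (Prod.fst ∘ chartAt (PhaseCoord m) p) p
      ((ContinuousLinearMap.fst ℝ (Coord m) (Fib m →L[ℝ] ℝ)).comp
        (mfderiv 𝓘(ℝ, PhaseCoord m) 𝓘(ℝ, PhaseCoord m) (chartAt (PhaseCoord m) p) p)) :=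
    HasMFDerivAt.comp p (hasFDerivAt_fst.hasMFDerivAt)
      ((mdifferentiable_chart (I := 𝓘(ℝ, PhaseCoord m)) p).mdifferentiableAt
        (mem_chart_source _ p)).hasMFDerivAt
  have h3 : (φ.toOpenPartialHomeomorph ∘ legendreBundle m π) =ᶠ[𝓝 p]
      (Prod.fst ∘ chartAt (PhaseCoord m) p) :=
    Filter.mem_of_superset ((chartAt (PhaseCoord m) p).open_source.mem_nhds
      (mem_chart_source _ p)) fun x hx =>
        (congrArg Prod.fst (φ.phaseChart_apply (p := x) hx)).symm
  have h4 := h3.mfderiv_eq (I := 𝓘(ℝ, PhaseCoord m)) (I' := 𝓘(ℝ, Coord m))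
  rw [h1.mfderiv, h2.mfderiv] at h4
  exact congrArg (fun l : TangentSpace 𝓘(ℝ, PhaseCoord m) p →L[ℝ] Coord m => l X) h4

theorem mfderiv_legendreBundle_phaseFrame_symm (p : Phase m π) (x : PhaseCoord m) :
    mfderiv 𝓘(ℝ, PhaseCoord m) 𝓘(ℝ, Coord m) (legendreBundle m π) p ((phaseFrame p).symm x) =
      ((bundleChartAt m π p.1).d (mem_bundleChartAt_source m π p.1)).symm x.1 := by
  refine ((bundleChartAt m π p.1).d (mem_bundleChartAt_source m π p.1)).injective ?_
  refine (d_mfderiv_legendreBundle p _).trans ?_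
  rw [ContinuousLinearEquiv.apply_symm_apply]
  exact (ContinuousLinearEquiv.apply_symm_apply _ _).symm

/-- The canonical lift of `u` is projected onto `u`. -/
theorem ConfigurationField.mfderiv_legendreBundle_lift (u : ConfigurationField m π)
    (p : Phase m π) :
    mfderiv 𝓘(ℝ, PhaseCoord m) 𝓘(ℝ, Coord m) (legendreBundle m π) p (u.lift p) =
      u.toFun p.1 := by
  have hq := mem_bundleChartAt_source m π p.1
  refine (mfderiv_legendreBundle_phaseFrame_symm p _).trans ?_
  refine ((bundleChartAt m π p.1).d hq).injective
    ((ContinuousLinearEquiv.apply_symm_apply _ _).trans ?_)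
  change u.components _ ((bundleChartAt m π p.1).phaseFun p).1 = _
  rw [(bundleChartAt m π p.1).phaseFun_apply hq]
  exact u.components_apply _ hq

namespace HamiltonianForm

variable (H : HamiltonianForm m π)

/-- The Hamilton vector field is projected onto the velocity of the Hamiltonian map. -/
theorem mfderiv_legendreBundle_hamiltonField (p : Phase m π) :
    mfderiv 𝓘(ℝ, PhaseCoord m) 𝓘(ℝ, Coord m) (legendreBundle m π) p (H.hamiltonField p) =
      (H.hamiltonianMap p).2.1 :=
  mfderiv_legendreBundle_phaseFrame_symm p _

theorem symmetryCurrent_lift (u : ConfigurationField m π) (p : Phase m π) :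
    H.symmetryCurrent u.lift p = H.toFun p (u.toFun p.1) :=
  congrArg (H.toFun p) (u.mfderiv_legendreBundle_lift p)

end HamiltonianForm

/-- The half `q^k_t = ∂^k 𝓗` of the Hamilton equation: the jet prolongation of the projection of a
solution is its image under the Hamiltonian map. -/
theorem jet_base_of_isSolution {H : HamiltonianForm m π}
    {r : LocalSection (PhaseCoord m) (π ∘ legendreBundle m π)} (hr : H.IsSolution r)
    (t : r.domain) : r.base.jet t = H.hamiltonianMap (r.toFun t) := by
  refine Sigma.ext rfl (heq_of_eq (Subtype.ext ?_))
  have h1 := (hr t t.2).hasMFDerivAt (r.isOpen_domain.mem_nhds t.2)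
  have h2 := HasMFDerivAt.comp (t : ℝ)
    ((contMDiff_legendreBundle m π).mdifferentiable (by simp) (r.toFun t)).hasMFDerivAt h1
  have h3 := congrArg (fun l : ℝ →L[ℝ] TangentSpace 𝓘(ℝ, Coord m) (r.toFun t).1 => l 1) h2.mfderiv
  refine h3.trans ?_
  rw [← H.mfderiv_legendreBundle_hamiltonField]
  change mfderiv 𝓘(ℝ, PhaseCoord m) 𝓘(ℝ, Coord m) (legendreBundle m π) (r.toFun t)
    ((1 : ℝ) • H.hamiltonField (r.toFun t)) = _
  rw [one_smul]

/-- The Poincaré--Cartan form at a jet `z` agrees with a Hamiltonian form at a point `p` over the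
same point of `Q` when `p = L̂(z)` and `L_H(p, z) = 𝓛(z)`. -/
theorem poincareCartan_eq (L : Lagrangian m π) (H : HamiltonianForm m π) (p : Phase m π)
    (v : JetFibre m π p.1) (hp : L.legendreMap ⟨p.1, v⟩ = p)
    (hv : H.lagrangian p v = L.toFun ⟨p.1, v⟩) :
    L.poincareCartan ⟨p.1, v⟩ = H.toFun p := by
  obtain ⟨q, ℓ⟩ := p
  have hℓ : L.legendre ⟨q, v⟩ = ℓ := eq_of_heq (Sigma.mk.inj hp).2
  ext X
  change L.legendre ⟨q, v⟩ (Lagrangian.vertPart ⟨q, v⟩ X) + L.toFun ⟨q, v⟩ * dt m π q X = _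
  rw [hℓ, ← H.restrict ⟨q, ℓ⟩, ← hv]
  change H.toFun ⟨q, ℓ⟩ (X - dt m π q X • v.1) + H.toFun ⟨q, ℓ⟩ v.1 * dt m π q X = _
  rw [map_sub, map_smul, smul_eq_mul]
  ring

end Mech

end

theorem theorem3p7 {m : ℕ} {Q : Type*} [TopologicalSpace Q] [T2Space Q]
    [SecondCountableTopology Q] [ChartedSpace (Mech.Coord m) Q]
    [IsManifold 𝓘(ℝ, Mech.Coord m) ∞ Q] (π : Q → ℝ) [Mech.ConfigurationBundle m π]
    (L : Mech.Lagrangian m π) (hL : L.IsAlmostRegular)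
    (H : Mech.HamiltonianForm m π) (hHL : H.IsAssociated L)
    (r : Mech.LocalSection (Mech.PhaseCoord m) (π ∘ Mech.legendreBundle m π))
    (hr : H.IsSolution r) (hrN : ∀ t ∈ r.domain, r.toFun t ∈ L.constraintSpace)
    (u : Mech.ConfigurationField m π) :
    (∀ t : r.domain, H.symmetryCurrent u.lift (r.toFun t) =
      L.symmetryCurrent u (r.base.jet t)) ∧
    (∀ t : r.domain, H.symmetryCurrent u.lift (L.legendreMap (r.base.jet t)) =
      L.symmetryCurrent u (r.base.jet t)) := by

  have hjet := fun t : r.domain => Mech.jet_base_of_isSolution hr t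
  have hleg : ∀ t : r.domain, L.legendreMap (H.hamiltonianMap (r.toFun t)) = r.toFun t := by
    intro t
    obtain ⟨z, hz⟩ := hrN t t.2
    rw [← hz]
    exact congrFun hHL.1 z
  have hcur : ∀ t : r.domain, H.symmetryCurrent u.lift (r.toFun t) =
      L.symmetryCurrent u (r.base.jet t) := by
    intro t
    rw [hjet t, H.symmetryCurrent_lift]
    exact congrArg (fun l => l (u.toFun (r.toFun t).1)) (Mech.poincareCartan_eq L H (r.toFun t)
      (H.hamiltonianMap (r.toFun t)).2 (hleg t) (hHL.2 _)).symm
  refine ⟨hcur, fun t => ?_⟩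
  rw [← hcur t, hjet t, hleg t]
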